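/- For a finite set $F\subset\mathbb{Z}^2$ let $r_i(F)=|\{y:(i,y)\in F\}|$ and $c_j(F)=|\{x:(x,j)\in F\}|$ be its row and column sums. Call $F$ uniquely determined by its row and column sums if no other finite subset of $\mathbb{Z}^2$ has the same row sums and the same column sums. For integers $\alpha,p\ge 0$ write $\beta=\sqrt{\alpha}\,(\alpha+1)$ and \[ B(\alpha,p)=p+\sqrt{\frac{\alpha}{4}\left(\beta+\sqrt{\beta(\alpha-1)+4(\alpha+1)p+\beta^2}+\frac{\alpha-1}{2}\right)^2-\frac{(\alpha-1)^2\alpha}{16}}. \] (1) Let $F_1,F_2$ be finite subsets of $\mathbb{Z}^2$ such that $F_1$ is uniquely determined by its row and column sums and $|F_1|=|F_2|$. Let $\alpha$ be the integer (under these assumptions it always exists) with \[ \sum_{j\in\mathbb{Z}}|c_j(F_1)-c_j(F_2)|+\sum_{i\in\mathbb{Z}}|r_i(F_1)-r_i(F_2)|=2\alpha, \] and let $p=|F_1\cap F_2|$. Then $|F_1|\le B(\alpha,p)$. (2) $B(\alpha,p)=p+O(\alpha\sqrt{p}+\alpha^2)$, that is, there is an absolute constant $C$ such that $|B(\alpha,p)-p|\le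 C(\alpha\sqrt p+\alpha^2)$ for all integers $\alpha,p\ge 0$. (3) $B(1,p)=p+1+\sqrt{2p+1}$ for all integers $p\ge 0$, and for all integers $n,p\ge0$ the inequality $n\le B(1,p)$ is equivalent to $p\ge n-\sqrt{2n}$. Hence for $\alpha=1$ the bound in (1) says $|F_1\cap F_2|\ge|F_1|-\sqrt{2|F_1|}$, which has the form of Alpers' bound $|F_1\cap F_2|\ge|F_1|+\tfrac12-\sqrt{2|F_1|+\tfrac14}$. -/

import Mathlib

namespace DiscreteTomography

/-- The row sum `r_i` of a finite set `F ⊆ ℤ²`: the number of points of `F` with first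
coordinate `i`. -/
def rowSum (F : Finset (ℤ × ℤ)) (i : ℤ) : ℕ := (F.filter (fun x => x.1 = i)).card

/-- The column sum `c_j` of a finite set `F ⊆ ℤ²`: the number of points of `F` with second
coordinate `j`. -/
def colSum (F : Finset (ℤ × ℤ)) (j : ℤ) : ℕ := (F.filter (fun x => x.2 = j)).card

/-- `F` is uniquely determined by its row and column sums: it is the only finite subset of `ℤ²`
that has these row and column sums. -/
def UniquelyDetermined (F : Finset (ℤ × ℤ)) : Prop :=
  ∀ G : Finset (ℤ × ℤ), (∀ i, rowSum G i = rowSum F i) → (∀ j, colSum G j = colSum F j) → G = F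

/-- The error in the line sums, `∑_j |c_j(F₁) - c_j(F₂)| + ∑_i |r_i(F₁) - r_i(F₂)|`. The sums run
over the columns and rows that meet `F₁ ∪ F₂`; all other lines contribute `0`. -/
def lineSumError (F₁ F₂ : Finset (ℤ × ℤ)) : ℤ :=
  ∑ j ∈ (F₁ ∪ F₂).image Prod.snd, |(colSum F₁ j : ℤ) - (colSum F₂ j : ℤ)| +
    ∑ i ∈ (F₁ ∪ F₂).image Prod.fst, |(rowSum F₁ i : ℤ) - (rowSum F₂ i : ℤ)|

/-- `β = √α (α + 1)`. -/
noncomputable def beta (α : ℕ) : ℝ := √(α : ℝ) * ((α : ℝ) + 1)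

/-- The square-root bound
`p + √((α/4) (β + √(β(α-1) + 4(α+1)p + β²) + (α-1)/2)² - (α-1)²α/16)`; all subtractions are
in `ℝ`. -/
noncomputable def sqrtBound (α p : ℕ) : ℝ :=
  (p : ℝ) + √((α : ℝ) / 4 *
      (beta α + √(beta α * ((α : ℝ) - 1) + 4 * ((α : ℝ) + 1) * (p : ℝ) + beta α ^ 2)
        + ((α : ℝ) - 1) / 2) ^ 2
    - ((α : ℝ) - 1) ^ 2 * (α : ℝ) / 16)

end DiscreteTomography

/-!
Write `F = F₁`, `D = F₁ \ F₂`, `E = F₂ \ F₁`, `m = |D| = |E|`, `N = |F| = p + m`, and let `u`, `v`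
be the numbers of rows and columns that meet `D`.

A uniquely determined set has no switching (`UniquelyDetermined.noSwitching`), so its rows are
nested and so are its columns: sorting the lines by their sums turns `F` into a Young diagram, whose
boundary separates `D` from `E`. The symmetric difference then looks like `α` staircases that zigzag
across the boundary; instead of decomposing it into such paths, one can count how much of it passes
over a given column.

* For each column `h`, the points of `D` whose row reaches `h` but which lie in `h` or before it,
  together with the points of `E` whose row ends before `h` but which lie beyond `h`, number at most
  `α` (`Staggered.cut_le`): their number is a difference of two partial sums of line errors. In
  particular a line contains at most `α` points of `D`.
* In a row with `d` points of `D` and equally many of `E`, these points pass over at least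
  `d (d + 1) / 2 + d (d - 1) / 2 = d²` columns of `D` in total; rows with fewer points of `E` lose at most
  `α (α - 1) / 2` altogether. Summing over the `v` columns of `D` gives `∑ d² ≤ α v + α (α - 1) / 2`
  (`Staggered.two_mul_sum_sq_le`), whence `m² ≤ α u (v + (α - 1) / 2)` by Cauchy-Schwarz
  (`Staggered.sq_card_le`).
* Since a line has at most `α` points of `D`, the `k`-th shortest row that meets `D` reaches at
  least `k / α` of the `v` columns, and misses at most `α (u - k)` of them. Summing the lengths of
  the rows gives `u v ≤ (α + 1) N` (`card_mul_card_le`).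

By transposition one may take `u ≤ v`. Then `u ≤ z` for `z² = (α + 1) N`, so that
`m² ≤ α z (z + (α - 1) / 2)`, and solving this inequality for `m` with `N = p + m` gives the bound
(`add_le_sqrtBound`). The other claims are elementary estimates.
-/

namespace DiscreteTomography

open Finset Function

/-! ### Ranks in a finite set -/

/-- With respect to an injective key `κ`, the ranks of the elements of `S` are `1, …, #S`. -/
theorem sum_rank_eq {ι K M : Type*} [LinearOrder K] [AddCommMonoid M] {κ : ι → K}
    {S : Finset ι} (hκ : Set.InjOn κ S) (g : ℕ → M) :
    ∑ i ∈ S, g (#{h ∈ S | κ h ≤ κ i}) = ∑ k ∈ range #S, g (k + 1) := by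
  classical
  induction S using Finset.induction_on_max_value κ with
  | empty => simp
  | insert a s ha hmax ih =>
    rw [sum_insert ha, card_insert_of_notMem ha, sum_range_succ, ← ih (hκ.mono (by simp)), add_comm]
    congr 1
    · refine sum_congr rfl fun i hi => ?_
      rw [filter_insert, if_neg]
      exact fun h => ha (hκ (by simp) (by simp [hi]) (le_antisymm h (hmax i hi)) ▸ hi)
    · rw [filter_true_of_mem, card_insert_of_notMem ha]
      intro x hx
      rcases mem_insert.1 hx with rfl | hx
      · exact le_rfl
      · exact hmax x hx

theorem two_mul_sum_card_le {ι K : Type*} [LinearOrder K] {κ : ι → K}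
    {S : Finset ι} (hκ : Set.InjOn κ S) :
    2 * ∑ i ∈ S, #{h ∈ S | κ h ≤ κ i} = #S * (#S + 1) := by
  rw [sum_rank_eq hκ (fun k => k), ← Finset.sum_range_succ' (fun k => k) #S |>.trans (add_zero _),
    mul_comm 2, Finset.sum_range_id_mul_two, Nat.add_sub_cancel, mul_comm]

theorem two_mul_sum_card_lt {ι K : Type*} [LinearOrder K] {κ : ι → K}
    {S : Finset ι} (hκ : Set.InjOn κ S) :
    2 * ∑ i ∈ S, #{h ∈ S | κ i < κ h} + #S = #S * #S := by
  have h1 := two_mul_sum_card_le hκ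
  have h2 : ∑ i ∈ S, #{h ∈ S | κ h ≤ κ i} + ∑ i ∈ S, #{h ∈ S | κ i < κ h} = #S * #S := by
    rw [← sum_add_distrib, ← smul_eq_mul, ← sum_const]
    refine sum_congr rfl fun i _ => ?_
    simpa only [not_le] using card_filter_add_card_filter_not (s := S) (fun h => κ h ≤ κ i)
  linarith

/-! ### Counting points that pass over a column -/

theorem sum_rowSum {D : Finset (ℤ × ℤ)} {I : Finset ℤ} (hI : ∀ x ∈ D, x.1 ∈ I) (P : ℤ → Prop)
    [DecidablePred P] : ∑ i ∈ I with P i, rowSum D i = #{x ∈ D | P x.1} := by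
  rw [card_eq_sum_card_fiberwise (f := Prod.fst) (t := I.filter P)]
  · refine sum_congr rfl fun i hi => ?_
    rw [filter_filter, rowSum]
    congr 1
    refine filter_congr fun x _ => ⟨fun h => ⟨h ▸ (mem_filter.1 hi).2, h⟩, fun h => h.2⟩
  · intro x hx
    simp only [coe_filter, Set.mem_ofPred_eq] at hx ⊢
    exact ⟨hI x hx.1, hx.2⟩

theorem sum_colSum {D : Finset (ℤ × ℤ)} {J : Finset ℤ} (hJ : ∀ x ∈ D, x.2 ∈ J) (P : ℤ → Prop)
    [DecidablePred P] : ∑ j ∈ J with P j, colSum D j = #{x ∈ D | P x.2} := by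
  rw [card_eq_sum_card_fiberwise (f := Prod.snd) (t := J.filter P)]
  · refine sum_congr rfl fun i hi => ?_
    rw [filter_filter, colSum]
    congr 1
    refine filter_congr fun x _ => ⟨fun h => ⟨h ▸ (mem_filter.1 hi).2, h⟩, fun h => h.2⟩
  · intro x hx
    simp only [coe_filter, Set.mem_ofPred_eq] at hx ⊢
    exact ⟨hJ x hx.1, hx.2⟩

/-- The surplus of `D` over `E` in the rows plus the surplus of `E` over `D` in the columns, in
truncated subtraction. If `D` and `E` have equally many points, then surplus and deficit agree in
each direction, so that this is half of the error in the line sums. -/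
def excess (I J : Finset ℤ) (D E : Finset (ℤ × ℤ)) : ℕ :=
  ∑ i ∈ I, (rowSum D i - rowSum E i) + ∑ j ∈ J, (colSum E j - colSum D j)

/-- `D` lies inside and `E` outside of a set `F` whose rows are upper sets for the order of the
columns given by the key `κ`: a row that contains a column contains all columns with a larger key.
The finite sets `I` and `J` contain all rows and columns that meet `D` or `E`. -/
structure Staggered {K : Type*} [LinearOrder K] (F D E : Finset (ℤ × ℤ)) (I J : Finset ℤ)
    (κ : ℤ → K) : Prop where
  mem_of_le : ∀ i j h, (i, j) ∈ F → κ j ≤ κ h → (i, h) ∈ F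
  injective : Injective κ
  subset : D ⊆ F
  notMem : ∀ x ∈ E, x ∉ F
  fst_mem : ∀ x ∈ D ∪ E, x.1 ∈ I
  snd_mem : ∀ x ∈ D ∪ E, x.2 ∈ J

section
variable {K : Type*} [LinearOrder K] {F D E : Finset (ℤ × ℤ)} {I J : Finset ℤ} {κ : ℤ → K}

/-- At most `excess I J D E` points of `D` and `E` pass over the column `h`. Here a point of `D` in
a row through `h` passes over `h` if it lies at or on the far side of `h`, seen from the boundary of
`F`, and a point of `E` in a row that does not reach `h` does so if it lies beyond `h`, or in a
column without points of `D`. The points by which `D` exceeds `E` in rows that do not reach `h` are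
counted as well. -/
theorem Staggered.cut_le (H : Staggered F D E I J κ) (h : ℤ) :
    #{x ∈ D | (x.1, h) ∈ F ∧ κ h ≤ κ x.2} +
      #{x ∈ E | (x.1, h) ∉ F ∧ (κ x.2 < κ h ∨ x.2 ∉ D.image Prod.snd)} +
      ∑ i ∈ I with (i, h) ∉ F, (rowSum D i - rowSum E i) ≤ excess I J D E := by
  have hDI : ∀ x ∈ D, x.1 ∈ I := fun x hx => H.fst_mem x (mem_union_left _ hx)
  have hEI : ∀ x ∈ E, x.1 ∈ I := fun x hx => H.fst_mem x (mem_union_right _ hx)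
  have hDJ : ∀ x ∈ D, x.2 ∈ J := fun x hx => H.snd_mem x (mem_union_left _ hx)
  have hEJ : ∀ x ∈ E, x.2 ∈ J := fun x hx => H.snd_mem x (mem_union_right _ hx)
  have rows : #{x ∈ D | (x.1, h) ∈ F} ≤
      #{x ∈ E | (x.1, h) ∈ F} + ∑ i ∈ I with (i, h) ∈ F, (rowSum D i - rowSum E i) := by
    rw [← sum_rowSum hDI (fun i => (i, h) ∈ F), ← sum_rowSum hEI (fun i => (i, h) ∈ F),
      ← sum_add_distrib]
    exact sum_le_sum fun i _ => by omega
  have cols : #{x ∈ E | κ x.2 < κ h ∨ x.2 ∉ D.image Prod.snd} ≤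
      #{x ∈ D | κ x.2 < κ h ∨ x.2 ∉ D.image Prod.snd} + ∑ j ∈ J, (colSum E j - colSum D j) := by
    rw [← sum_colSum hDJ (fun j => κ j < κ h ∨ j ∉ D.image Prod.snd),
      ← sum_colSum hEJ (fun j => κ j < κ h ∨ j ∉ D.image Prod.snd)]
    refine le_trans ?_ (Nat.add_le_add_left
      (sum_le_sum_of_subset (filter_subset (fun j => κ j < κ h ∨ j ∉ D.image Prod.snd) J)) _)
    rw [← sum_add_distrib]
    exact sum_le_sum fun i _ => by omega
  have splitI := sum_filter_add_sum_filter_not I (fun i => (i, h) ∈ F)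
    (fun i => rowSum D i - rowSum E i)
  have splitD : #{x ∈ D | (x.1, h) ∈ F} = #{x ∈ D | (x.1, h) ∈ F ∧ κ h ≤ κ x.2} +
      #{x ∈ D | κ x.2 < κ h ∨ x.2 ∉ D.image Prod.snd} := by
    rw [← card_filter_add_card_filter_not (s := {x ∈ D | (x.1, h) ∈ F}) (fun x => κ h ≤ κ x.2),
      filter_filter, filter_filter]
    congr 2
    refine filter_congr fun x hx => ?_
    rw [not_le]
    refine ⟨fun hx' => Or.inl hx'.2, ?_⟩
    rintro (hx' | hx')
    · exact ⟨H.mem_of_le _ _ _ (H.subset hx) hx'.le, hx'⟩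
    · exact absurd (mem_image_of_mem _ hx) hx'
  have splitE : #{x ∈ E | κ x.2 < κ h ∨ x.2 ∉ D.image Prod.snd} = #{x ∈ E | (x.1, h) ∈ F} +
      #{x ∈ E | (x.1, h) ∉ F ∧ (κ x.2 < κ h ∨ x.2 ∉ D.image Prod.snd)} := by
    rw [← card_filter_add_card_filter_not
      (s := {x ∈ E | κ x.2 < κ h ∨ x.2 ∉ D.image Prod.snd}) (fun x => (x.1, h) ∈ F),
      filter_filter, filter_filter]
    congr 2
    · refine filter_congr fun x hx => ⟨fun hx' => hx'.2, fun hx' => ⟨Or.inl ?_, hx'⟩⟩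
      by_contra hlt
      exact H.notMem x hx (H.mem_of_le _ _ _ hx' (not_lt.1 hlt))
    · exact filter_congr fun x _ => and_comm
  unfold excess
  omega

theorem Staggered.colSum_le (H : Staggered F D E I J κ) (h : ℤ) :
    colSum D h ≤ excess I J D E := by
  refine le_trans (card_le_card fun x hx => ?_)
    (le_trans (Nat.le_add_right _ _) (le_trans (Nat.le_add_right _ _) (H.cut_le h)))
  obtain ⟨hxD, rfl⟩ := mem_filter.1 hx
  exact mem_filter.2 ⟨hxD, H.subset hxD, le_rfl⟩

theorem Staggered.rowSum_le (H : Staggered F D E I J κ) (i : ℤ) :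
    rowSum D i ≤ excess I J D E := by
  rcases (D.filter fun x => x.1 = i).eq_empty_or_nonempty with hS | hS
  · simp [rowSum, hS]
  obtain ⟨y, hy, hmin⟩ := exists_min_image _ (fun x => κ x.2) hS
  obtain ⟨hyD, rfl⟩ := mem_filter.1 hy
  refine le_trans (card_le_card fun x hx => ?_)
    (le_trans (Nat.le_add_right _ _) (le_trans (Nat.le_add_right _ _) (H.cut_le y.2)))
  have hx' := mem_filter.1 hx
  exact mem_filter.2 ⟨hx'.1, by rw [hx'.2]; exact H.subset hyD, hmin x hx⟩

/-- The points of row `i` pass over at least `d²` columns of `D`, where `d = rowSum D i`, up to a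
loss of `g (g - 1) / 2`; a surplus of `D` over `E` counts towards all columns that the row does not
reach. Here `g` counts the points of `E` in columns without points of `D`, and the missing points of
`E` in the row. -/
theorem Staggered.row_contribution (H : Staggered F D E I J κ) (i : ℤ) :
    2 * rowSum D i ^ 2 ≤
      2 * (∑ x ∈ D with x.1 = i, #{h ∈ D.image Prod.snd | (x.1, h) ∈ F ∧ κ h ≤ κ x.2} +
        ∑ x ∈ E with x.1 = i,
          #{h ∈ D.image Prod.snd | (x.1, h) ∉ F ∧ (κ x.2 < κ h ∨ x.2 ∉ D.image Prod.snd)} +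
        #{h ∈ D.image Prod.snd | (i, h) ∉ F} * (rowSum D i - rowSum E i)) +
      (#{x ∈ E | x.1 = i ∧ x.2 ∉ D.image Prod.snd} + (rowSum D i - rowSum E i)) *
      (#{x ∈ E | x.1 = i ∧ x.2 ∉ D.image Prod.snd} + (rowSum D i - rowSum E i) - 1) := by
  set C := D.image Prod.snd with hC
  have inj : ∀ A : Finset (ℤ × ℤ), (∀ x ∈ A, x.1 = i) → Set.InjOn (fun x : ℤ × ℤ => κ x.2) A := by
    intro A hA x hx y hy hxy
    exact Prod.ext ((hA x hx).trans (hA y hy).symm) (H.injective hxy)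
  -- In a row, the columns of a set of points are as many as the points themselves.
  have snd_le : ∀ (A : Finset (ℤ × ℤ)) (B : Finset ℤ), (∀ x ∈ A, x.1 = i) →
      (∀ x ∈ A, x.2 ∈ B) → #A ≤ #B := by
    intro A B hA hB
    refine card_le_card_of_injOn Prod.snd hB fun x hx y hy hxy => ?_
    exact Prod.ext ((hA x hx).trans (hA y hy).symm) hxy
  have hE : rowSum E i = #{x ∈ E | x.1 = i ∧ x.2 ∈ C} + #{x ∈ E | x.1 = i ∧ x.2 ∉ C} := by
    rw [← filter_filter, ← filter_filter, card_filter_add_card_filter_not, rowSum]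
  have w1 : rowSum D i * (rowSum D i + 1) ≤
      2 * ∑ x ∈ D with x.1 = i, #{h ∈ C | (x.1, h) ∈ F ∧ κ h ≤ κ x.2} := by
    rw [rowSum, ← two_mul_sum_card_le (inj {x ∈ D | x.1 = i} fun x hx => (mem_filter.1 hx).2)]
    refine Nat.mul_le_mul_left _ (sum_le_sum fun x hx => ?_)
    refine snd_le _ _ (fun y hy => (mem_filter.1 (mem_filter.1 hy).1).2) fun y hy => ?_
    obtain ⟨hy, hyx⟩ := mem_filter.1 hy
    obtain ⟨hyD, hyi⟩ := mem_filter.1 hy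
    refine mem_filter.2 ⟨mem_image_of_mem _ hyD, ?_, hyx⟩
    rw [(mem_filter.1 hx).2, ← hyi]
    exact H.subset hyD
  have hq : #{x ∈ E | x.1 = i ∧ x.2 ∈ C} ≤ #{h ∈ C | (i, h) ∉ F} := by
    refine snd_le _ _ (fun y hy => (mem_filter.1 hy).2.1) fun y hy => ?_
    obtain ⟨hyE, hyi, hyC⟩ := mem_filter.1 hy
    exact mem_filter.2 ⟨hyC, by rw [← hyi]; exact H.notMem y hyE⟩
  have w2 : #{x ∈ E | x.1 = i ∧ x.2 ∈ C} * #{x ∈ E | x.1 = i ∧ x.2 ∈ C} +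
      2 * (#{x ∈ E | x.1 = i ∧ x.2 ∉ C} * #{h ∈ C | (i, h) ∉ F}) ≤
      2 * ∑ x ∈ E with x.1 = i, #{h ∈ C | (x.1, h) ∉ F ∧ (κ x.2 < κ h ∨ x.2 ∉ C)} +
      #{x ∈ E | x.1 = i ∧ x.2 ∈ C} := by
    rw [← sum_filter_add_sum_filter_not {x ∈ E | x.1 = i} (fun x => x.2 ∈ C), filter_filter,
      filter_filter, ← two_mul_sum_card_lt
        (inj {x ∈ E | x.1 = i ∧ x.2 ∈ C} fun x hx => (mem_filter.1 hx).2.1), ← smul_eq_mul (#_),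
      ← sum_const]
    have h1 : ∑ x ∈ E with x.1 = i ∧ x.2 ∈ C,
        #{y ∈ {x ∈ E | x.1 = i ∧ x.2 ∈ C} | κ x.2 < κ y.2} ≤
        ∑ x ∈ E with x.1 = i ∧ x.2 ∈ C,
          #{h ∈ C | (x.1, h) ∉ F ∧ (κ x.2 < κ h ∨ x.2 ∉ C)} := by
      refine sum_le_sum fun x hx => ?_
      refine snd_le _ _ (fun y hy => (mem_filter.1 (mem_filter.1 hy).1).2.1) fun y hy => ?_
      obtain ⟨hy, hyx⟩ := mem_filter.1 hy
      obtain ⟨hyE, hyi, hyC⟩ := mem_filter.1 hy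
      refine mem_filter.2 ⟨hyC, ?_, Or.inl hyx⟩
      rw [(mem_filter.1 hx).2.1, ← hyi]
      exact H.notMem y hyE
    have h2 : ∑ x ∈ E with x.1 = i ∧ x.2 ∉ C, #{h ∈ C | (i, h) ∉ F} ≤
        ∑ x ∈ E with x.1 = i ∧ x.2 ∉ C,
          #{h ∈ C | (x.1, h) ∉ F ∧ (κ x.2 < κ h ∨ x.2 ∉ C)} := by
      refine sum_le_sum fun x hx => card_le_card fun h hh => ?_
      obtain ⟨-, hxi, hxC⟩ := mem_filter.1 hx
      obtain ⟨hhC, hhF⟩ := mem_filter.1 hh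
      exact mem_filter.2 ⟨hhC, by rwa [hxi], Or.inr hxC⟩
    omega
  generalize ∑ x ∈ D with x.1 = i, #{h ∈ C | (x.1, h) ∈ F ∧ κ h ≤ κ x.2} = W₁ at *
  generalize ∑ x ∈ E with x.1 = i,
    #{h ∈ C | (x.1, h) ∉ F ∧ (κ x.2 < κ h ∨ x.2 ∉ C)} = W₂ at *
  generalize #{h ∈ C | (i, h) ∉ F} = q at *
  generalize #{x ∈ E | x.1 = i ∧ x.2 ∈ C} = e at *
  generalize #{x ∈ E | x.1 = i ∧ x.2 ∉ C} = o at *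
  generalize hg : rowSum D i - rowSum E i = t at *
  have hd : rowSum D i ≤ e + (o + t) := by omega
  generalize rowSum D i = d at *
  have hqo := Nat.mul_le_mul_left o hq
  have hqt := Nat.mul_le_mul_right t hq
  have hg' : (o + t) * (o + t - 1) + (o + t) = (o + t) * (o + t) := by
    cases o + t with
    | zero => rfl
    | succ n => simp only [Nat.add_sub_cancel]; ring
  have hmono : d * d + (e + (o + t)) ≤ (e + (o + t)) * (e + (o + t)) + d := by
    obtain ⟨k, hk⟩ := Nat.exists_eq_add_of_le hd
    rw [hk]
    nlinarith [Nat.zero_le (d * k), Nat.le_mul_self k]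
  nlinarith

/-- Double counting of the pairs of a column of `D` and a point that passes over it. -/
theorem Staggered.two_mul_sum_sq_le (H : Staggered F D E I J κ) :
    2 * ∑ i ∈ I, rowSum D i ^ 2 ≤
      2 * (excess I J D E * #(D.image Prod.snd)) + excess I J D E * (excess I J D E - 1) := by
  have cut := sum_le_sum fun h (_ : h ∈ D.image Prod.snd) => H.cut_le h
  rw [sum_const, smul_eq_mul, sum_add_distrib, sum_add_distrib] at cut
  have hDI : ∀ x ∈ D, x.1 ∈ I := fun x hx => H.fst_mem x (mem_union_left _ hx)
  have hEI : ∀ x ∈ E, x.1 ∈ I := fun x hx => H.fst_mem x (mem_union_right _ hx)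
  have hEJ : ∀ x ∈ E, x.2 ∈ J := fun x hx => H.snd_mem x (mem_union_right _ hx)
  have swapD := sum_card_bipartiteAbove_eq_sum_card_bipartiteBelow (s := D.image Prod.snd) (t := D)
    (fun h x => (x.1, h) ∈ F ∧ κ h ≤ κ x.2)
  have swapE := sum_card_bipartiteAbove_eq_sum_card_bipartiteBelow (s := D.image Prod.snd) (t := E)
    (fun h x => (x.1, h) ∉ F ∧ (κ x.2 < κ h ∨ x.2 ∉ D.image Prod.snd))
  have swapI : ∑ h ∈ D.image Prod.snd, ∑ i ∈ I with (i, h) ∉ F, (rowSum D i - rowSum E i) =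
      ∑ i ∈ I, #{h ∈ D.image Prod.snd | (i, h) ∉ F} * (rowSum D i - rowSum E i) := by
    simp_rw [sum_filter]
    rw [sum_comm]
    refine sum_congr rfl fun i _ => ?_
    rw [← sum_filter, sum_const, smul_eq_mul]
  simp only [bipartiteAbove, bipartiteBelow] at swapD swapE
  rw [swapD, swapE, swapI, ← sum_fiberwise_of_maps_to hDI, ← sum_fiberwise_of_maps_to hEI,
    ← sum_add_distrib, ← sum_add_distrib] at cut
  have ends : ∑ i ∈ I, (#{x ∈ E | x.1 = i ∧ x.2 ∉ D.image Prod.snd} +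
      (rowSum D i - rowSum E i)) ≤ excess I J D E := by
    rw [sum_add_distrib, excess, add_comm]
    refine Nat.add_le_add_left ?_ _
    have : ∑ i ∈ I, #{x ∈ E | x.1 = i ∧ x.2 ∉ D.image Prod.snd} =
        #{x ∈ E | x.2 ∉ D.image Prod.snd} := by
      rw [card_eq_sum_card_fiberwise (f := Prod.fst) (t := I)
        (fun x hx => hEI x (mem_filter.1 hx).1)]
      refine sum_congr rfl fun i _ => ?_
      rw [filter_filter]
      simp only [and_comm]
    rw [this, ← sum_colSum hEJ (fun j => j ∉ D.image Prod.snd)]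
    refine le_trans (le_of_eq (sum_congr rfl fun j hj => ?_))
      (sum_le_sum_of_subset (filter_subset (fun j => j ∉ D.image Prod.snd) J))
    have : colSum D j = 0 := by
      rw [colSum, card_eq_zero, filter_eq_empty_iff]
      rintro x hx rfl
      exact (mem_filter.1 hj).2 (mem_image_of_mem _ hx)
    omega
  have rows := sum_le_sum fun i (_ : i ∈ I) => H.row_contribution i
  rw [← mul_sum, sum_add_distrib, ← mul_sum] at rows
  refine rows.trans (add_le_add ?_ ?_)
  · rw [mul_comm (excess I J D E)]
    exact Nat.mul_le_mul_left _ cut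
  · refine le_trans (sum_le_sum fun i hi => Nat.mul_le_mul_left _ (Nat.sub_le_sub_right
      ((single_le_sum (fun _ _ => Nat.zero_le _) hi).trans ends) 1)) ?_
    rw [← sum_mul]
    exact Nat.mul_le_mul_right _ ends

theorem Staggered.sq_card_le (H : Staggered F D E I J κ) :
    2 * #D ^ 2 ≤ #(D.image Prod.fst) *
      (2 * (excess I J D E * #(D.image Prod.snd)) + excess I J D E * (excess I J D E - 1)) := by
  have hsub : D.image Prod.fst ⊆ I := image_subset_iff.2 fun x hx =>
    H.fst_mem x (mem_union_left _ hx)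
  have hcard : #D = ∑ i ∈ D.image Prod.fst, rowSum D i :=
    card_eq_sum_card_fiberwise (f := Prod.fst) fun x hx => by
      simpa using ⟨x.2, hx⟩
  have cs := sq_sum_le_card_mul_sum_sq (s := D.image Prod.fst) (f := fun i => rowSum D i)
  rw [← hcard] at cs
  have hle : ∑ i ∈ D.image Prod.fst, rowSum D i ^ 2 ≤ ∑ i ∈ I, rowSum D i ^ 2 :=
    sum_le_sum_of_subset hsub
  calc 2 * #D ^ 2 ≤ 2 * (#(D.image Prod.fst) * ∑ i ∈ D.image Prod.fst, rowSum D i ^ 2) :=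
        Nat.mul_le_mul_left _ cs
    _ = #(D.image Prod.fst) * (2 * ∑ i ∈ D.image Prod.fst, rowSum D i ^ 2) := by ring
    _ ≤ _ := Nat.mul_le_mul_left _ ((Nat.mul_le_mul_left _ hle).trans H.two_mul_sum_sq_le)
end

/-! ### The area of the diagram -/

theorem sum_range_div {a : ℝ} (ha : a ≠ 0) (n : ℕ) :
    2 * a * ∑ k ∈ range n, ((k : ℝ) + 1) / a = n * (n + 1) := by
  induction n with
  | zero => simp
  | succ n ih =>
    rw [sum_range_succ, mul_add, ih]
    push_cast
    field_simp
    ring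

theorem sum_range_affine (a w : ℝ) (n : ℕ) :
    2 * ∑ k ∈ range n, (w + a * k) = n * (2 * w + a * (n - 1)) := by
  induction n with
  | zero => simp
  | succ n ih =>
    rw [sum_range_succ, mul_add, ih]
    push_cast
    ring

/-- A lower bound for the area under a staircase of `u` steps and final height `v` whose slopes lie
between `1 / a` and `a`. -/
theorem mul_le_sum_max {a u v : ℕ} (ha : 1 ≤ a) (huv : u ≤ a * v) (hvu : v ≤ a * u) :
    (u : ℝ) * v ≤ (a + 1) *
      ∑ k ∈ range u, max (((k : ℝ) + 1) / a) ((v : ℝ) - a * (u - (k + 1))) := by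
  have ha' : (1 : ℝ) ≤ a := by exact_mod_cast ha
  have huv' : (u : ℝ) ≤ a * v := by exact_mod_cast huv
  have hvu' : (v : ℝ) ≤ a * u := by exact_mod_cast hvu
  have hu0 : (0 : ℝ) ≤ u := u.cast_nonneg
  have hv0 : (0 : ℝ) ≤ v := v.cast_nonneg
  -- The first `u - L` terms are bounded by the first argument of the maximum and the last `L` by
  -- the second. The two arguments cross near `L = (a v - u) / (a² - 1)`, which is rounded up.
  obtain ⟨L, hLu, hL1, hL2⟩ : ∃ L ≤ u, (a * v - u : ℝ) ≤ (a ^ 2 - 1) * L ∧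
      ((a : ℝ) ^ 2 - 1) * L ≤ a * v - u + (a ^ 2 - 1) := by
    rcases ha.eq_or_lt with rfl | ha2
    · refine ⟨0, Nat.zero_le _, ?_, ?_⟩ <;> norm_num at * <;> linarith
    · have ha2' : (1 : ℝ) < a := by exact_mod_cast ha2
      have hD : (0 : ℝ) < (a : ℝ) ^ 2 - 1 := by nlinarith
      have hy0 : 0 ≤ (a * v - u : ℝ) / ((a : ℝ) ^ 2 - 1) :=
        div_nonneg (by linarith) hD.le
      refine ⟨⌈(a * v - u : ℝ) / ((a : ℝ) ^ 2 - 1)⌉₊, ?_, ?_, ?_⟩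
      · rw [Nat.ceil_le, div_le_iff₀ hD]
        nlinarith
      · rw [← div_le_iff₀' hD]
        exact Nat.le_ceil _
      · have := (Nat.ceil_lt_add_one hy0).le
        rw [div_add_one hD.ne', le_div_iff₀ hD] at this
        linarith
  obtain ⟨n, rfl⟩ := Nat.exists_eq_add_of_le' hLu
  rw [sum_range_add]
  have s1 : ∑ k ∈ range n, ((k : ℝ) + 1) / a ≤ ∑ k ∈ range n,
      max (((k : ℝ) + 1) / a) ((v : ℝ) - a * ((n + L : ℕ) - (k + 1))) :=
    sum_le_sum fun _ _ => le_max_left _ _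
  have s2 : ∑ k ∈ range L, ((v - a * (L - 1) : ℝ) + a * k) ≤ ∑ k ∈ range L,
      max ((((n + k : ℕ) : ℝ) + 1) / a)
        ((v : ℝ) - a * ((n + L : ℕ) - (((n + k : ℕ) : ℝ) + 1))) := by
    refine sum_le_sum fun k _ => le_trans (le_of_eq ?_) (le_max_right _ _)
    push_cast
    ring
  have e1 := sum_range_div (a := (a : ℝ)) (by linarith) n
  have e2 := sum_range_affine (a : ℝ) (v - a * (L - 1)) L
  refine le_trans ?_ (mul_le_mul_of_nonneg_left (add_le_add s1 s2) (by linarith))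
  generalize ∑ k ∈ range n, ((k : ℝ) + 1) / a = A at *
  generalize ∑ k ∈ range L, ((v - a * (L - 1) : ℝ) + a * k) = B at *
  push_cast at *
  generalize (a : ℝ) = a at *
  generalize (v : ℝ) = v at *
  have hn : (n : ℝ) = (n + L) - L := by ring
  have hL0 : (0 : ℝ) ≤ L := L.cast_nonneg
  generalize (n : ℝ) + L = u at *
  generalize (L : ℝ) = l at *
  rw [hn] at e1
  have e : 2 * a * ((a + 1) * (A + B)) =
      (a + 1) * (u ^ 2 + u + l * (2 * (a * v - u) - (a ^ 2 - 1) * l + (a ^ 2 - 1))) := by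
    linear_combination (a + 1) * e1 + a * (a + 1) * e2
  refine le_of_mul_le_mul_left ?_ (by linarith : (0 : ℝ) < 2 * a)
  rw [e]
  rcases ha'.eq_or_lt with rfl | ha2
  · norm_num at *
    have : u = v := le_antisymm huv' hvu'
    subst this
    nlinarith
  · have key : (a * v - u) ^ 2 + (a * v - u) * (a ^ 2 - 1) ≤
        (a ^ 2 - 1) * (l * (2 * (a * v - u) - (a ^ 2 - 1) * l + (a ^ 2 - 1))) := by
      nlinarith [mul_nonneg (sub_nonneg.2 hL1) (sub_nonneg.2 hL2)]
    refine le_of_mul_le_mul_left ?_ (sub_pos.2 ha2)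
    have h3 : 0 ≤ a ^ 2 * (u - v) ^ 2 + (a ^ 2 - 1) * (a * v) :=
      add_nonneg (by positivity) (mul_nonneg (by nlinarith) (by nlinarith))
    linarith

/-- The area bound: the rows and columns that meet `D` span at most `(a + 1) * #F` cells, if no line
contains more than `a` points of `D` and the columns of `F` are upper sets for the key `τ`. -/
theorem card_mul_card_le {K : Type*} [LinearOrder K] {F D : Finset (ℤ × ℤ)} {a : ℕ} {τ : ℤ → K}
    (hτ : Injective τ) (hF : ∀ i i' j, (i, j) ∈ F → τ i ≤ τ i' → (i', j) ∈ F) (hDF : D ⊆ F)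
    (hrow : ∀ i, rowSum D i ≤ a) (hcol : ∀ j, colSum D j ≤ a) (ha : 1 ≤ a) :
    #(D.image Prod.fst) * #(D.image Prod.snd) ≤ (a + 1) * #F := by
  set R := D.image Prod.fst with hR
  set C := D.image Prod.snd with hC
  have ha0 : (0 : ℝ) < a := by exact_mod_cast ha
  -- A family of rows of `D` has at most `a` rows for each column that meets it, and dually.
  have rows_le : ∀ (A B : Finset ℤ), A ⊆ R → (∀ x ∈ D, x.1 ∈ A → x.2 ∈ B) → #A ≤ a * #B := by
    intro A B hA hB
    have h1 : #A ≤ #{x ∈ D | x.2 ∈ B} := by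
      refine (card_le_card fun i hi => ?_).trans
        (card_image_le (s := {x ∈ D | x.2 ∈ B}) (f := Prod.fst))
      obtain ⟨x, hx, rfl⟩ := mem_image.1 (hA hi)
      exact mem_image_of_mem _ (mem_filter.2 ⟨hx, hB x hx hi⟩)
    refine h1.trans ?_
    refine card_le_mul_card_image_of_maps_to (f := Prod.snd)
      (fun x hx => (mem_filter.1 hx).2) a fun j _ => (card_le_card ?_).trans (hcol j)
    exact filter_subset_filter _ (filter_subset _ _)
  have cols_le : ∀ (A B : Finset ℤ), A ⊆ C → (∀ x ∈ D, x.2 ∈ A → x.1 ∈ B) → #A ≤ a * #B := by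
    intro A B hA hB
    have h1 : #A ≤ #{x ∈ D | x.1 ∈ B} := by
      refine (card_le_card fun i hi => ?_).trans
        (card_image_le (s := {x ∈ D | x.1 ∈ B}) (f := Prod.snd))
      obtain ⟨x, hx, rfl⟩ := mem_image.1 (hA hi)
      exact mem_image_of_mem _ (mem_filter.2 ⟨hx, hB x hx hi⟩)
    refine h1.trans ?_
    refine card_le_mul_card_image_of_maps_to (f := Prod.fst)
      (fun x hx => (mem_filter.1 hx).2) a fun j _ => (card_le_card ?_).trans (hrow j)
    exact filter_subset_filter _ (filter_subset _ _)
  have numeric := mul_le_sum_max ha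
    (rows_le R C subset_rfl fun x hx _ => mem_image_of_mem _ hx)
    (cols_le C R subset_rfl fun x hx _ => mem_image_of_mem _ hx)
  have hrank := sum_rank_eq (hτ.injOn (s := (R : Set ℤ)))
    fun k => max ((k : ℝ) / a) ((#C : ℝ) - a * (#R - k))
  push_cast at hrank
  rw [← hrank] at numeric
  have area : ∑ i ∈ R, #{h ∈ C | (i, h) ∈ F} ≤ #F := by
    rw [← card_sigma]
    refine card_le_card_of_injOn (fun x => (x.1, x.2)) (fun x hx => ?_) fun x _ y _ hxy => ?_
    · exact (mem_filter.1 (mem_sigma.1 hx).2).2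
    · obtain ⟨h1, h2⟩ := Prod.mk.inj hxy
      exact Sigma.ext h1 (heq_of_eq h2)
  have bound : ∀ i ∈ R, max (((#{h ∈ R | τ h ≤ τ i} : ℕ) : ℝ) / a)
      ((#C : ℝ) - a * (#R - (#{h ∈ R | τ h ≤ τ i} : ℕ))) ≤ (#{h ∈ C | (i, h) ∈ F} : ℕ) := by
    intro i _
    refine max_le ?_ ?_
    · rw [div_le_iff₀' ha0]
      exact_mod_cast rows_le _ _ (filter_subset _ _) fun x hx hxi => mem_filter.2
        ⟨mem_image_of_mem _ hx, hF _ _ _ (hDF hx) (mem_filter.1 hxi).2⟩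
    · have h1 : #{h ∈ C | (i, h) ∉ F} ≤ a * #{h ∈ R | ¬ τ h ≤ τ i} :=
        cols_le _ _ (filter_subset _ _) fun x hx hxi => mem_filter.2
          ⟨mem_image_of_mem _ hx, fun hle => (mem_filter.1 hxi).2 (hF _ _ _ (hDF hx) hle)⟩
      have h2 := card_filter_add_card_filter_not (s := C) (fun h => (i, h) ∈ F)
      have h3 := card_filter_add_card_filter_not (s := R) (fun h => τ h ≤ τ i)
      have h1' : ((#{h ∈ C | (i, h) ∉ F} : ℕ) : ℝ) ≤ a * (#{h ∈ R | ¬ τ h ≤ τ i} : ℕ) := by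
        exact_mod_cast h1
      rw [← h2, ← h3]
      push_cast
      linarith
  have total : (#R : ℝ) * #C ≤ (a + 1) * #F := by
    refine numeric.trans (mul_le_mul_of_nonneg_left ?_ (by linarith))
    refine (sum_le_sum bound).trans ?_
    exact_mod_cast area
  exact_mod_cast total

/-! ### Solving for the number of points -/

/-- With `m² ≤ a u (v + (a - 1) / 2)` and `u v ≤ (a + 1) (p + m)`, the bound follows for `u ≤ v`. -/
theorem add_le_sqrtBound {a p : ℕ} {m u v : ℝ} (ha : 1 ≤ a) (hm : 0 ≤ m) (hu : 0 ≤ u)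
    (huv : u ≤ v) (harea : u * v ≤ (a + 1) * (p + m))
    (hsq : m ^ 2 ≤ a * u * (v + (a - 1) / 2)) : p + m ≤ sqrtBound a p := by
  have ha' : (1 : ℝ) ≤ a := by exact_mod_cast ha
  have hp : (0 : ℝ) ≤ p := p.cast_nonneg
  unfold sqrtBound beta
  generalize (p : ℝ) = p at *
  generalize (a : ℝ) = a at *
  have ha0 : 0 < a := by linarith
  set s := √a
  have hs : s ^ 2 = a := Real.sq_sqrt ha0.le
  have hs0 : 0 ≤ s := Real.sqrt_nonneg _
  set β := s * (a + 1)
  have hβ : 0 ≤ β := by positivity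
  set S := √(β * (a - 1) + 4 * (a + 1) * p + β ^ 2)
  have hS0 : 0 ≤ S := Real.sqrt_nonneg _
  have hS : S ^ 2 = β * (a - 1) + 4 * (a + 1) * p + β ^ 2 := by
    refine Real.sq_sqrt ?_
    have : 0 ≤ β * (a - 1) := mul_nonneg hβ (by linarith)
    positivity
  obtain ⟨z, hz0, hz⟩ : ∃ z : ℝ, 0 ≤ z ∧ z ^ 2 = (a + 1) * (p + m) :=
    ⟨√((a + 1) * (p + m)), Real.sqrt_nonneg _, Real.sq_sqrt (by positivity)⟩
  have huz : u ≤ z := by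
    refine le_of_sq_le_sq ?_ hz0
    nlinarith
  have hmz : m ^ 2 ≤ a * (z ^ 2 + z * ((a - 1) / 2)) := by
    refine hsq.trans ?_
    rw [mul_assoc]
    refine mul_le_mul_of_nonneg_left ?_ ha0.le
    nlinarith
  -- `y` is the nonnegative root of `4 m² = a y (y + a - 1)`.
  obtain ⟨y, hy0, hy⟩ : ∃ y : ℝ, 0 ≤ y ∧ a * (y * (y + (a - 1))) = 4 * m ^ 2 := by
    have hq : √((a - 1) ^ 2 + 16 * m ^ 2 / a) ^ 2 = (a - 1) ^ 2 + 16 * m ^ 2 / a :=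
      Real.sq_sqrt (by positivity)
    refine ⟨(√((a - 1) ^ 2 + 16 * m ^ 2 / a) - (a - 1)) / 2, ?_, ?_⟩
    · have : a - 1 ≤ √((a - 1) ^ 2 + 16 * m ^ 2 / a) :=
        Real.le_sqrt_of_sq_le (le_add_of_nonneg_right (by positivity))
      linarith
    · have h1 : a * (√((a - 1) ^ 2 + 16 * m ^ 2 / a) ^ 2 - (a - 1) ^ 2) = 16 * m ^ 2 := by
        rw [hq]
        field_simp
        ring
      linear_combination h1 / 4
  have hyz : y ≤ 2 * z := by
    by_contra! hlt
    nlinarith [mul_pos ha0 (sub_pos.2 hlt), mul_nonneg ha0.le (sub_nonneg.2 ha')]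
  have hmy : 2 * m ≤ s * (y + (a - 1) / 2) := by
    refine le_of_sq_le_sq ?_ (mul_nonneg hs0 (by linarith))
    rw [mul_pow s, hs]
    nlinarith [sq_nonneg (a - 1)]
  have hyS : y - β ≤ S := by
    refine le_of_sq_le_sq ?_ hS0
    rw [hS]
    -- The square of `y - β` is bounded by eliminating `m` from these two estimates.
    have h1 : y ^ 2 ≤ 4 * ((a + 1) * (p + m)) := by rw [← hz]; nlinarith
    have h2 : 4 * (a + 1) * m ≤ β * (2 * y + (a - 1)) := by
      have := mul_le_mul_of_nonneg_left hmy (by linarith : 0 ≤ 2 * (a + 1))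
      calc 4 * (a + 1) * m = 2 * (a + 1) * (2 * m) := by ring
        _ ≤ 2 * (a + 1) * (s * (y + (a - 1) / 2)) := this
        _ = β * (2 * y + (a - 1)) := by simp only [β]; ring
    nlinarith
  refine add_le_add_right (Real.le_sqrt_of_sq_le ?_) _
  have hx : y * (y + (a - 1)) ≤ (β + S) * (β + S + (a - 1)) :=
    mul_le_mul (by linarith) (by linarith) (by linarith) (by linarith)
  have := mul_le_mul_of_nonneg_left hx ha0.le
  linarith

/-! ### Sets without switchings -/

theorem rowSum_insert {F : Finset (ℤ × ℤ)} {x : ℤ × ℤ} (hx : x ∉ F) (k : ℤ) :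
    rowSum (insert x F) k = rowSum F k + if x.1 = k then 1 else 0 := by
  unfold rowSum
  rw [filter_insert]
  split_ifs
  · rw [card_insert_of_notMem fun h => hx (mem_filter.1 h).1]
  · rfl

theorem colSum_insert {F : Finset (ℤ × ℤ)} {x : ℤ × ℤ} (hx : x ∉ F) (k : ℤ) :
    colSum (insert x F) k = colSum F k + if x.2 = k then 1 else 0 := by
  unfold colSum
  rw [filter_insert]
  split_ifs
  · rw [card_insert_of_notMem fun h => hx (mem_filter.1 h).1]
  · rfl

/-- No rectangle has one pair of opposite corners in `F` and the other pair outside of `F`; that is,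
the rows of `F` are linearly ordered by inclusion, and so are its columns. -/
def NoSwitching (F : Finset (ℤ × ℤ)) : Prop :=
  ∀ i j i' j', (i, j) ∈ F → (i', j') ∈ F → (i, j') ∈ F ∨ (i', j) ∈ F

theorem UniquelyDetermined.noSwitching {F : Finset (ℤ × ℤ)} (hF : UniquelyDetermined F) :
    NoSwitching F := by
  intro i j i' j' h1 h2
  by_contra! h
  obtain ⟨h3, h4⟩ := h
  have hi : i ≠ i' := by rintro rfl; exact h3 h2
  have hj : j ≠ j' := by rintro rfl; exact h3 h1
  -- `B` is the part of `F` that is common to `F` and the switched set.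
  set B := (F.erase (i, j)).erase (i', j') with hB
  have e1 : (i', j') ∉ B := notMem_erase _ _
  have e2 : (i, j) ∉ insert (i', j') B := by simp [hB, hi]
  have e3 : (i', j) ∉ B := fun h => h4 (mem_of_mem_erase (mem_of_mem_erase h))
  have e4 : (i, j') ∉ insert (i', j) B := by
    simp only [mem_insert, Prod.mk.injEq, not_or]
    exact ⟨fun h => hi h.1, fun h => h3 (mem_of_mem_erase (mem_of_mem_erase h))⟩
  have hFB : F = insert (i, j) (insert (i', j') B) := by
    rw [hB, insert_erase, insert_erase h1]
    exact mem_erase.2 ⟨fun h => hi (Prod.mk.inj h).1.symm, h2⟩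
  have hG := hF (insert (i, j') (insert (i', j) B))
    (fun k => by
      rw [hFB, rowSum_insert e4, rowSum_insert e3, rowSum_insert e2, rowSum_insert e1])
    (fun k => by
      rw [hFB, colSum_insert e4, colSum_insert e3, colSum_insert e2, colSum_insert e1]
      simp only
      omega)
  exact h3 (hG ▸ mem_insert_self _ _)

/-- A key that sorts the columns by their sums; ties are broken by position. -/
def colKey (F : Finset (ℤ × ℤ)) (j : ℤ) : ℕ ×ₗ ℤ := toLex (colSum F j, j)

theorem colKey_injective (F : Finset (ℤ × ℤ)) : Injective (colKey F) := fun _ _ h =>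
  (Prod.mk.inj (toLex.injective h)).2

theorem NoSwitching.mem_of_colKey_le {F : Finset (ℤ × ℤ)} (hF : NoSwitching F) (i j h : ℤ)
    (hij : (i, j) ∈ F) (hle : colKey F j ≤ colKey F h) : (i, h) ∈ F := by
  by_contra hih
  have hlt : colSum F h < colSum F j := by
    -- `x ↦ (x.1, j)` maps the column of `h` into the column of `j` and misses `(i, j)`.
    rw [colSum, colSum, ← card_image_of_injOn (s := {x ∈ F | x.2 = h}) (f := fun x => (x.1, j))]
    · refine card_lt_card (ssubset_iff_of_subset ?_ |>.2 ⟨(i, j), by simpa using hij, ?_⟩)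
      · intro y hy
        obtain ⟨x, hx, rfl⟩ := mem_image.1 hy
        obtain ⟨hxF, rfl⟩ := mem_filter.1 hx
        exact mem_filter.2 ⟨(hF _ _ _ _ hij hxF).resolve_left hih, rfl⟩
      · intro hy
        obtain ⟨x, hx, hxi⟩ := mem_image.1 hy
        obtain ⟨hxF, rfl⟩ := mem_filter.1 hx
        exact hih ((Prod.mk.inj hxi).1 ▸ hxF)
    · intro x hx y hy hxy
      have hx := (mem_filter.1 (mem_coe.1 hx)).2
      have hy := (mem_filter.1 (mem_coe.1 hy)).2
      exact Prod.ext (Prod.mk.inj hxy).1 (hx.trans hy.symm)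
  have : colSum F j ≤ colSum F h := by
    rcases Prod.Lex.le_iff.1 hle with h1 | h1
    · exact h1.le
    · exact h1.1.le
  omega

/-- The reflection of `F` that exchanges rows and columns. -/
def transpose (F : Finset (ℤ × ℤ)) : Finset (ℤ × ℤ) := F.map (Equiv.prodComm ℤ ℤ).toEmbedding

theorem mk_mem_transpose {F : Finset (ℤ × ℤ)} {i j : ℤ} : (i, j) ∈ transpose F ↔ (j, i) ∈ F := by
  simp [transpose]

theorem rowSum_transpose (F : Finset (ℤ × ℤ)) (i : ℤ) : rowSum (transpose F) i = colSum F i := by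
  rw [rowSum, transpose, filter_map, card_map]
  rfl

theorem colSum_transpose (F : Finset (ℤ × ℤ)) (j : ℤ) : colSum (transpose F) j = rowSum F j := by
  rw [colSum, transpose, filter_map, card_map]
  rfl

theorem NoSwitching.transpose {F : Finset (ℤ × ℤ)} (hF : NoSwitching F) :
    NoSwitching (transpose F) := by
  intro i j i' j' h1 h2
  simp only [mk_mem_transpose] at *
  exact (hF _ _ _ _ h1 h2).symm

/-! ### The line sum error -/

theorem sum_abs_sub_eq {ι : Type*} {s : Finset ι} {f g : ι → ℕ}
    (h : ∑ i ∈ s, f i = ∑ i ∈ s, g i) :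
    ∑ i ∈ s, |(f i : ℤ) - g i| = 2 * (∑ i ∈ s, (f i - g i) : ℕ) := by
  have h1 : ∑ i ∈ s, |(f i : ℤ) - g i| =
      (∑ i ∈ s, (f i - g i) : ℕ) + (∑ i ∈ s, (g i - f i) : ℕ) := by
    push_cast only [Nat.cast_sum]
    rw [← sum_add_distrib]
    exact sum_congr rfl fun i _ => by
      rcases abs_cases ((f i : ℤ) - g i) with h | h <;> omega
  have h2 : ∑ i ∈ s, (f i - g i) + ∑ i ∈ s, g i = ∑ i ∈ s, (g i - f i) + ∑ i ∈ s, f i := by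
    rw [← sum_add_distrib, ← sum_add_distrib]
    exact sum_congr rfl fun i _ => by omega
  omega

theorem rowSum_sdiff_add (F G : Finset (ℤ × ℤ)) (i : ℤ) :
    rowSum (F \ G) i + rowSum (F ∩ G) i = rowSum F i := by
  unfold rowSum
  rw [← card_union_of_disjoint, ← filter_union, sdiff_union_inter]
  exact disjoint_filter_filter (disjoint_sdiff_inter F G)

theorem colSum_sdiff_add (F G : Finset (ℤ × ℤ)) (j : ℤ) :
    colSum (F \ G) j + colSum (F ∩ G) j = colSum F j := by
  unfold colSum
  rw [← card_union_of_disjoint, ← filter_union, sdiff_union_inter]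
  exact disjoint_filter_filter (disjoint_sdiff_inter F G)

theorem lineSumError_eq {F₁ F₂ : Finset (ℤ × ℤ)} (hcard : #F₁ = #F₂) :
    lineSumError F₁ F₂ = 2 * (excess ((F₁ ∪ F₂).image Prod.fst) ((F₁ ∪ F₂).image Prod.snd)
      (F₁ \ F₂) (F₂ \ F₁) : ℕ) := by
  have rows : ∑ i ∈ (F₁ ∪ F₂).image Prod.fst, rowSum F₁ i =
      ∑ i ∈ (F₁ ∪ F₂).image Prod.fst, rowSum F₂ i := by
    have h1 := sum_rowSum (D := F₁) (I := (F₁ ∪ F₂).image Prod.fst)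
      (fun x hx => mem_image_of_mem _ (mem_union_left _ hx)) (fun _ => True)
    have h2 := sum_rowSum (D := F₂) (I := (F₁ ∪ F₂).image Prod.fst)
      (fun x hx => mem_image_of_mem _ (mem_union_right _ hx)) (fun _ => True)
    simp only [filter_true] at h1 h2
    omega
  have cols : ∑ j ∈ (F₁ ∪ F₂).image Prod.snd, colSum F₂ j =
      ∑ j ∈ (F₁ ∪ F₂).image Prod.snd, colSum F₁ j := by
    have h1 := sum_colSum (D := F₁) (J := (F₁ ∪ F₂).image Prod.snd)
      (fun x hx => mem_image_of_mem _ (mem_union_left _ hx)) (fun _ => True)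
    have h2 := sum_colSum (D := F₂) (J := (F₁ ∪ F₂).image Prod.snd)
      (fun x hx => mem_image_of_mem _ (mem_union_right _ hx)) (fun _ => True)
    simp only [filter_true] at h1 h2
    omega
  unfold lineSumError excess
  rw [sum_abs_sub_eq rows, sum_congr rfl fun j _ => abs_sub_comm _ _, sum_abs_sub_eq cols,
    Nat.cast_add, mul_add, add_comm]
  congr 3
  · refine sum_congr rfl fun i _ => ?_
    have h1 := rowSum_sdiff_add F₁ F₂ i
    have h2 := rowSum_sdiff_add F₂ F₁ i
    rw [inter_comm] at h2
    omega
  · refine sum_congr rfl fun i _ => ?_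
    have h1 := colSum_sdiff_add F₁ F₂ i
    have h2 := colSum_sdiff_add F₂ F₁ i
    rw [inter_comm] at h2
    omega

theorem NoSwitching.staggered {F₁ F₂ : Finset (ℤ × ℤ)} (hF : NoSwitching F₁) :
    Staggered F₁ (F₁ \ F₂) (F₂ \ F₁) ((F₁ ∪ F₂).image Prod.fst) ((F₁ ∪ F₂).image Prod.snd)
      (colKey F₁) where
  mem_of_le := hF.mem_of_colKey_le
  injective := colKey_injective F₁
  subset := sdiff_subset
  notMem := fun _ hx => (mem_sdiff.1 hx).2
  fst_mem := fun _ hx => mem_image_of_mem _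
    (union_subset_union sdiff_subset sdiff_subset hx)
  snd_mem := fun _ hx => mem_image_of_mem _
    (union_subset_union sdiff_subset sdiff_subset hx)

/-! ### The bound -/

theorem card_le_sqrtBound_of_le {F₁ F₂ : Finset (ℤ × ℤ)} {α : ℕ} (hF : NoSwitching F₁)
    (hcard : #F₁ = #F₂) (hα : lineSumError F₁ F₂ = 2 * (α : ℤ))
    (hle : #((F₁ \ F₂).image Prod.fst) ≤ #((F₁ \ F₂).image Prod.snd)) :
    (#F₁ : ℝ) ≤ sqrtBound α #(F₁ ∩ F₂) := by
  have H := hF.staggered (F₂ := F₂)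
  have hex := lineSumError_eq hcard
  rw [hα] at hex
  replace hex : excess ((F₁ ∪ F₂).image Prod.fst) ((F₁ ∪ F₂).image Prod.snd)
    (F₁ \ F₂) (F₂ \ F₁) = α := by omega
  have hrow := H.rowSum_le
  have hcol := H.colSum_le
  have hsq := H.sq_card_le
  rw [hex] at hrow hcol hsq
  have hN : (#F₁ : ℝ) = (#(F₁ ∩ F₂) : ℕ) + (#(F₁ \ F₂) : ℕ) := by
    exact_mod_cast (card_inter_add_card_sdiff F₁ F₂).symm
  rcases Nat.eq_zero_or_pos α with rfl | hα1
  · have : #(F₁ \ F₂) = 0 := by simpa using hsq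
    rw [hN, this, Nat.cast_zero, add_zero, sqrtBound]
    exact le_add_of_nonneg_right (Real.sqrt_nonneg _)
  have harea := card_mul_card_le (colKey_injective (transpose F₁)) (fun i i' j hij h =>
    mk_mem_transpose.1 (hF.transpose.mem_of_colKey_le j i i' (mk_mem_transpose.2 hij) h))
    (sdiff_subset (s := F₁) (t := F₂)) hrow hcol hα1
  rw [hN]
  refine add_le_sqrtBound hα1 (Nat.cast_nonneg _) (Nat.cast_nonneg _) (Nat.cast_le.2 hle) ?_ ?_
  · rw [← hN]
    exact_mod_cast harea
  · have hsq' : (2 * #(F₁ \ F₂) ^ 2 : ℝ) ≤ #((F₁ \ F₂).image Prod.fst) *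
        (2 * (α * #((F₁ \ F₂).image Prod.snd)) + α * (α - 1 : ℕ)) := by
      exact_mod_cast hsq
    rw [Nat.cast_sub hα1, Nat.cast_one] at hsq'
    linarith

theorem transpose_union (F G : Finset (ℤ × ℤ)) :
    transpose (F ∪ G) = transpose F ∪ transpose G := map_union _ _

theorem image_fst_transpose (F : Finset (ℤ × ℤ)) :
    (transpose F).image Prod.fst = F.image Prod.snd := by
  ext i; simp [transpose]

theorem image_snd_transpose (F : Finset (ℤ × ℤ)) :
    (transpose F).image Prod.snd = F.image Prod.fst := by
  ext i; simp [transpose]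

theorem lineSumError_transpose (F G : Finset (ℤ × ℤ)) :
    lineSumError (transpose F) (transpose G) = lineSumError F G := by
  unfold lineSumError
  rw [← transpose_union, image_fst_transpose, image_snd_transpose, add_comm]
  simp only [rowSum_transpose, colSum_transpose]

theorem card_le_sqrtBound {F₁ F₂ : Finset (ℤ × ℤ)} {α : ℕ} (hF : UniquelyDetermined F₁)
    (hcard : #F₁ = #F₂) (hα : lineSumError F₁ F₂ = 2 * (α : ℤ)) :
    (#F₁ : ℝ) ≤ sqrtBound α #(F₁ ∩ F₂) := by
  rcases le_total #((F₁ \ F₂).image Prod.fst) #((F₁ \ F₂).image Prod.snd) with hle | hle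
  · exact card_le_sqrtBound_of_le hF.noSwitching hcard hα hle
  · have hsdiff : transpose F₁ \ transpose F₂ = transpose (F₁ \ F₂) := by
      ext ⟨i, j⟩
      simp only [mem_sdiff, mk_mem_transpose]
    have hinter : transpose F₁ ∩ transpose F₂ = transpose (F₁ ∩ F₂) := by
      ext ⟨i, j⟩
      simp only [mem_inter, mk_mem_transpose]
    have key := card_le_sqrtBound_of_le (F₂ := transpose F₂) (α := α) hF.noSwitching.transpose
      (by simpa [transpose] using hcard) (by rwa [lineSumError_transpose])
      (by rwa [hsdiff, image_fst_transpose, image_snd_transpose])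
    rw [hinter] at key
    simpa [transpose] using key

/-! ### The size of the bound -/

theorem abs_sqrtBound_sub_le (α p : ℕ) :
    |sqrtBound α p - p| ≤ 3 * (α * √p + α ^ 2) := by
  rw [sqrtBound, add_sub_cancel_left, abs_of_nonneg (Real.sqrt_nonneg _)]
  rcases Nat.eq_zero_or_pos α with rfl | hα
  · simp
  have hα' : (1 : ℝ) ≤ α := by exact_mod_cast hα
  have hs : √(α : ℝ) ^ 2 = α := Real.sq_sqrt (by linarith)
  have hs1 : 1 ≤ √(α : ℝ) := Real.one_le_sqrt.2 hα'
  have hq : √(p : ℝ) ^ 2 = p := Real.sq_sqrt p.cast_nonneg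
  have hq0 : 0 ≤ √(p : ℝ) := Real.sqrt_nonneg _
  unfold beta
  set s := √(α : ℝ)
  set q := √(p : ℝ)
  rw [← hs, ← hq]
  have hs0 : 0 ≤ s := by linarith
  have h2 : 1 ≤ s ^ 2 := one_le_pow₀ hs1
  have hβ : s * (s ^ 2 + 1) ≤ 2 * s ^ 3 := by nlinarith
  have hβ0 : 0 ≤ s * (s ^ 2 + 1) := by positivity
  set β := s * (s ^ 2 + 1)
  have hS : √(β * (s ^ 2 - 1) + 4 * (s ^ 2 + 1) * q ^ 2 + β ^ 2) ≤ 3 * s ^ 3 + 3 * s * q := by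
    refine Real.sqrt_le_iff.2 ⟨by positivity, ?_⟩
    have h3 : β * (s ^ 2 - 1) ≤ 2 * s ^ 6 := by
      calc β * (s ^ 2 - 1) ≤ 2 * s ^ 3 * s ^ 2 :=
            mul_le_mul hβ (by linarith) (by linarith) (by positivity)
        _ = 2 * s ^ 5 * 1 := by ring
        _ ≤ 2 * s ^ 5 * s := mul_le_mul_of_nonneg_left hs1 (by positivity)
        _ = 2 * s ^ 6 := by ring
    have h4 : 4 * (s ^ 2 + 1) * q ^ 2 ≤ 8 * s ^ 2 * q ^ 2 :=
      mul_le_mul_of_nonneg_right (by linarith) (by positivity)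
    have h5 : β ^ 2 ≤ (2 * s ^ 3) ^ 2 := pow_le_pow_left₀ hβ0 hβ 2
    have h6 : 0 ≤ s ^ 4 * q := by positivity
    nlinarith [sq_nonneg (s ^ 3), sq_nonneg (s * q)]
  have hS0 := Real.sqrt_nonneg (β * (s ^ 2 - 1) + 4 * (s ^ 2 + 1) * q ^ 2 + β ^ 2)
  set S := √(β * (s ^ 2 - 1) + 4 * (s ^ 2 + 1) * q ^ 2 + β ^ 2)
  have hs23 : s ^ 2 ≤ s ^ 3 := pow_le_pow_right₀ hs1 (by norm_num)
  have hx : β + S + (s ^ 2 - 1) / 2 ≤ 6 * s ^ 3 + 6 * s * q := by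
    have : 0 ≤ s * q := by positivity
    linarith
  have hx0 : 0 ≤ β + S + (s ^ 2 - 1) / 2 := by linarith
  refine Real.sqrt_le_iff.2 ⟨by positivity, ?_⟩
  have h7 := mul_le_mul_of_nonneg_left (pow_le_pow_left₀ hx0 hx 2)
    (by positivity : 0 ≤ s ^ 2 / 4)
  have h8 : 0 ≤ (s ^ 2 - 1) ^ 2 * s ^ 2 / 16 := by positivity
  have h9 : s ^ 2 / 4 * (6 * s ^ 3 + 6 * s * q) ^ 2 = (3 * (s ^ 2 * q + (s ^ 2) ^ 2)) ^ 2 := by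
    ring
  linarith

theorem sqrtBound_one (p : ℕ) : sqrtBound 1 p = p + 1 + √(2 * p + 1) := by
  have h1 : √((8 : ℝ) * p + 4) = 2 * √(2 * p + 1) := by
    rw [show (8 : ℝ) * p + 4 = 2 ^ 2 * (2 * p + 1) by ring, Real.sqrt_mul (by norm_num),
      Real.sqrt_sq (by norm_num)]
  have h2 : √((1 + √(2 * (p : ℝ) + 1)) ^ 2) = 1 + √(2 * p + 1) :=
    Real.sqrt_sq (by positivity)
  have h3 : beta 1 = 2 := by norm_num [beta]
  rw [sqrtBound, h3, add_assoc (p : ℝ) 1, ← h2]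
  congr 2
  norm_num
  rw [h1]
  ring

theorem le_sqrtBound_one_iff (n p : ℕ) :
    (n : ℝ) ≤ sqrtBound 1 p ↔ (n : ℝ) - √(2 * n) ≤ p := by
  rw [sqrtBound_one]
  have hp : (0 : ℝ) ≤ p := p.cast_nonneg
  have hn : (0 : ℝ) ≤ n := n.cast_nonneg
  have hw0 := Real.sqrt_nonneg (2 * (n : ℝ))
  rcases le_or_gt n (p + 1) with h | h
  · have h' : (n : ℝ) ≤ p + 1 := by exact_mod_cast h
    refine iff_of_true (by linarith [Real.sqrt_nonneg (2 * (p : ℝ) + 1)]) ?_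
    rcases Nat.eq_zero_or_pos n with rfl | hn1
    · simp
    · have : 1 ≤ √(2 * (n : ℝ)) := Real.one_le_sqrt.2 (by
        have : (1 : ℝ) ≤ n := by exact_mod_cast hn1
        linarith)
      linarith
  · have h' : (p : ℝ) + 1 < n := by exact_mod_cast h
    rw [← sub_le_iff_le_add', Real.le_sqrt (by linarith) (by linarith), sub_le_comm,
      Real.le_sqrt (by linarith) (by linarith)]
    constructor <;> intro h <;> nlinarith

end DiscreteTomography

theorem mainTheorem5 :
    -- the explicit bound
    (∀ (F₁ F₂ : Finset (ℤ × ℤ)) (α : ℕ),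
      DiscreteTomography.UniquelyDetermined F₁ →
      F₁.card = F₂.card →
      DiscreteTomography.lineSumError F₁ F₂ = 2 * (α : ℤ) →
      (F₁.card : ℝ) ≤ DiscreteTomography.sqrtBound α (F₁ ∩ F₂).card) ∧
    -- its size is `p + O(α √p + α²)`, with an absolute constant
    (∃ C : ℝ, ∀ α p : ℕ,
      |DiscreteTomography.sqrtBound α p - (p : ℝ)| ≤
        C * ((α : ℝ) * √(p : ℝ) + (α : ℝ) ^ 2)) ∧
    -- its value for `α = 1`
    (∀ p : ℕ, DiscreteTomography.sqrtBound 1 p = (p : ℝ) + 1 + √(2 * (p : ℝ) + 1)) ∧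
    -- the form of Alpers' bound to which the case `α = 1` is equivalent
    (∀ n p : ℕ, (n : ℝ) ≤ DiscreteTomography.sqrtBound 1 p ↔
      (n : ℝ) - √(2 * (n : ℝ)) ≤ (p : ℝ)) :=
  ⟨fun _ _ _ hF hcard hα => DiscreteTomography.card_le_sqrtBound hF hcard hα,
    ⟨3, DiscreteTomography.abs_sqrtBound_sub_le⟩, DiscreteTomography.sqrtBound_one,
    DiscreteTomography.le_sqrtBound_one_iff⟩
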